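/- Let $X$ and $Z$ be complex Hilbert spaces, $E:X\to Z$ a bounded linear operator with closed range, and $A:D(A)\subset X\to Z$ a densely defined closed linear operator with adjoint $A^*:D(A^*)\subset Z\to X$. Let $\varrho(E,A)$ be the set of all $s\in\mathbb C$ for which $sE-A:D(A)\to Z$ has an everywhere defined bounded inverse $(sE-A)^{-1}:Z\to X$, and for $s\in\varrho(E,A)$ put $$R^E(s,A)=(sE-A)^{-1}E,\qquad L^E(s,A)=E(sE-A)^{-1}.$$ Suppose that $\lambda\in\varrho(E,A)$ for some real $\lambda>0$ and that $$\operatorname{Re}\langle Ax,Ex\rangle_Z\le 0\quad(x\in D(A)),\qquad \operatorname{Re}\langle A^*z,E^*z\rangle_X\le 0\quad(z\in D(A^*)).$$ Let $\alpha\in\varrho(E,A)$ and put $$X^0=\ker E,\quad X^1=\overline{\operatorname{ran}R^E(\alpha,A)},\quad Z^0=\{Ax\mid x\in D(A)\cap\ker E\},\quad Z^1=\operatorname{ran}E.$$ Then the following hold. 1. $X^1$ does not depend on the choice of $\alpha\in\varrho(E,A)$, and $X=X^0\oplus X^1$, $Z=Z^0\oplus Z^1$ (direct sums, not asserted to be orthogonal).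 2. $(0,\infty)\subset\varrho(E,A)$, and the limits $$Px=\lim_{s\to\infty}sR^E(s,A)x\quad(x\in X),\qquad Qz=\lim_{s\to\infty}sL^E(s,A)z\quad(z\in Z)$$ ($s$ real) exist and define bounded projections $P$ on $X$ and $Q$ on $Z$ with $\operatorname{ran}P=X^1$, $\ker P=X^0$, $\operatorname{ran}Q=Z^1$, $\ker Q=Z^0$. 3. The restriction $E_1=E|_{X^1}:X^1\to Z^1$ is boundedly invertible. $A$ maps $D(A)\cap X^1$ into $Z^1$, and the restriction $A_1:D(A_1)\subset X^1\to Z^1$ of $A$ to $D(A_1)=X^1\cap D(A)$ is closed and densely defined in $X^1$. 4. Let $J\subset\mathbb R$ be an interval with more than one point, and let $x=x^0+x^1:J\to X$ with $x^0:J\to X^0$ and $x^1:J\to X^1$. Then $x$ is a solution on $J$ of $\frac{d}{dt}(Ex)=Ax$ if and only if $(x^0,x^1)$ is a solution on $J$ of $$\frac{d}{dt}\begin{bmatrix}0&0\\0&I\end{bmatrix}\begin{bmatrix}x^0\\x^1\end{bmatrix}=\begin{bmatrix}I&0\\0&E_1^{-1}A_1\end{bmatrix}\begin{bmatrix}x^0\\x^1\end{bmatrix},$$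 that is, of the algebraic equation $0=x^0$ and the differential equation $\frac{d}{dt}x^1=E_1^{-1}A_1x^1$. Here a solution on $J$ of an equation $\frac{d}{dt}(Fw)=Gw$ is a function $w:J\to D(G)$ such that $Fw$ is differentiable on $J$ (one-sidedly at endpoints belonging to $J$) with derivative $Gw$; the block operator on the right has domain $X^0\times D(A_1)$. The same equivalence holds for classical solutions, that is, solutions for which in addition $Gw$ is continuous on $J$. 5. $E_1^{-1}A_1$, with domain $X^1\cap D(A)$, is the infinitesimal generator of a strongly continuous semigroup of contractions on $X^1$ (with the norm of $X$). -/

import Mathlib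

open Filter Topology
open scoped NNReal InnerProductSpace

noncomputable section

namespace DAE

section Pencil

variable {X Z : Type*} [NormedAddCommGroup X] [NormedSpace ℂ X]
  [NormedAddCommGroup Z] [NormedSpace ℂ Z]

/-- The operator `s E - A` with domain `D(A)`. -/
def pencil (E : X →L[ℂ] Z) (A : X →ₗ.[ℂ] Z) (s : ℂ) : X →ₗ.[ℂ] Z where
  domain := A.domain
  toFun := (s • E).toLinearMap.comp A.domain.subtype - A.toFun

/-- `R` is an everywhere defined bounded two-sided inverse of the operator `T`. -/
def IsBoundedInverse (T : X →ₗ.[ℂ] Z) (R : Z →L[ℂ] X) : Prop :=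
  (∀ x : T.domain, R (T x) = x) ∧ ∀ z : Z, ∃ h : R z ∈ T.domain, T ⟨R z, h⟩ = z

theorem IsBoundedInverse.unique {T : X →ₗ.[ℂ] Z} {R R' : Z →L[ℂ] X}
    (hR : IsBoundedInverse T R) (hR' : IsBoundedInverse T R') : R = R' := by
  ext z
  obtain ⟨h, hz⟩ := hR.2 z
  have h1 := hR'.1 ⟨R z, h⟩
  rw [hz] at h1
  exact h1.symm

/-- The resolvent set `ϱ(E, A)` of the operator pencil `(E, A)`. -/
def resolventSet (E : X →L[ℂ] Z) (A : X →ₗ.[ℂ] Z) : Set ℂ :=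
  {s | ∃ R : Z →L[ℂ] X, IsBoundedInverse (pencil E A s) R}

open scoped Classical in
/-- The operator `(s E - A)⁻¹` for `s ∈ ϱ(E, A)` (and `0` for other `s`). -/
def resolvent (E : X →L[ℂ] Z) (A : X →ₗ.[ℂ] Z) (s : ℂ) : Z →L[ℂ] X :=
  if h : s ∈ resolventSet E A then h.choose else 0

theorem resolvent_spec {E : X →L[ℂ] Z} {A : X →ₗ.[ℂ] Z} {s : ℂ}
    (h : s ∈ resolventSet E A) : IsBoundedInverse (pencil E A s) (resolvent E A s) := by
  rw [resolvent, dif_pos h]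
  exact h.choose_spec

/-- The right resolvent `R^E(s, A) = (s E - A)⁻¹ E`. -/
def rightResolvent (E : X →L[ℂ] Z) (A : X →ₗ.[ℂ] Z) (s : ℂ) : X →L[ℂ] X :=
  (resolvent E A s).comp E

/-- The left resolvent `L^E(s, A) = E (s E - A)⁻¹`. -/
def leftResolvent (E : X →L[ℂ] Z) (A : X →ₗ.[ℂ] Z) (s : ℂ) : Z →L[ℂ] Z :=
  E.comp (resolvent E A s)

/-- `X⁰ = ker E`. -/
def X0 (E : X →L[ℂ] Z) : Submodule ℂ X := LinearMap.ker E.toLinearMap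

/-- `X¹`, the closure of the range of `R^E(α, A)`. -/
def X1 (E : X →L[ℂ] Z) (A : X →ₗ.[ℂ] Z) (α : ℂ) : Submodule ℂ X :=
  (LinearMap.range (rightResolvent E A α).toLinearMap).topologicalClosure

/-- `Z⁰ = {A x | x ∈ D(A) ∩ ker E}`. -/
def Z0 (E : X →L[ℂ] Z) (A : X →ₗ.[ℂ] Z) : Submodule ℂ Z :=
  ((X0 E).comap A.domain.subtype).map A.toFun

/-- `Z¹ = ran E`. -/
def Z1 (E : X →L[ℂ] Z) : Submodule ℂ Z := LinearMap.range E.toLinearMap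

/-- The restriction of `E` to an operator `X¹ → Z¹`. -/
def E1 (E : X →L[ℂ] Z) (A : X →ₗ.[ℂ] Z) (α : ℂ) : X1 E A α →L[ℂ] Z1 E :=
  (E.comp (X1 E A α).subtypeL).codRestrict (Z1 E) (fun x => ⟨(x : X), rfl⟩)

/-- The restriction of `A` to an operator `p → q` with domain `p ∩ D(A)`. -/
def restrict (A : X →ₗ.[ℂ] Z) (p : Submodule ℂ X) (q : Submodule ℂ Z)
    (h : ∀ x : A.domain, (x : X) ∈ p → A x ∈ q) : p →ₗ.[ℂ] q where
  domain := A.domain.comap p.subtype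
  toFun :=
    { toFun := fun x => ⟨A ⟨((x : p) : X), x.2⟩, h _ (x : p).2⟩
      map_add' := fun x y => Subtype.ext (A.map_add ⟨((x : p) : X), x.2⟩ ⟨((y : p) : X), y.2⟩)
      map_smul' := fun c x => Subtype.ext (A.map_smul c ⟨((x : p) : X), x.2⟩) }

/-- The operator `A₁ : X¹ ∩ D(A) ⊆ X¹ → Z¹`, given that `A` maps `X¹ ∩ D(A)` into `Z¹`. -/
def A1 (E : X →L[ℂ] Z) (A : X →ₗ.[ℂ] Z) (α : ℂ)
    (h : ∀ x : A.domain, (x : X) ∈ X1 E A α → A x ∈ Z1 E) : X1 E A α →ₗ.[ℂ] Z1 E :=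
  restrict A (X1 E A α) (Z1 E) h

/-- The operator `E₁⁻¹ A₁` in `X¹`, with domain `X¹ ∩ D(A)`. It is meaningful when `E₁` is
boundedly invertible. -/
def E1invA1 (E : X →L[ℂ] Z) (A : X →ₗ.[ℂ] Z) (α : ℂ)
    (h : ∀ x : A.domain, (x : X) ∈ X1 E A α → A x ∈ Z1 E) : X1 E A α →ₗ.[ℂ] X1 E A α :=
  (E1 E A α).inverse.toLinearMap.compPMap (A1 E A α h)

/-- `x` solves `d/dt (E x) = A x` on the interval `J`: `x(t) ∈ D(A)`, and `E x` is differentiable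
at `t` (one-sidedly at endpoints of `J`) with derivative `A x(t)`, for all `t ∈ J`. -/
def IsSolution (E : X →L[ℂ] Z) (A : X →ₗ.[ℂ] Z) (J : Set ℝ) (x : ℝ → X) : Prop :=
  ∀ t ∈ J, ∃ h : x t ∈ A.domain, HasDerivWithinAt (fun r => E (x r)) (A ⟨x t, h⟩) J t

/-- A classical solution: in addition, `A x` (hence the derivative of `E x`) is continuous
on `J`. -/
def IsClassicalSolution (E : X →L[ℂ] Z) (A : X →ₗ.[ℂ] Z) (J : Set ℝ) (x : ℝ → X) : Prop :=
  IsSolution E A J x ∧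
    ∃ y : ℝ → Z, ContinuousOn y J ∧ ∀ t ∈ J, ∃ h : x t ∈ A.domain, A ⟨x t, h⟩ = y t

end Pencil

section Block

variable (U : Type*) {V : Type*} [NormedAddCommGroup U] [NormedSpace ℂ U]
  [NormedAddCommGroup V] [NormedSpace ℂ V]

/-- The block operator `[0 0; 0 I]` on `U × V`. -/
def blockE (V : Type*) [NormedAddCommGroup V] [NormedSpace ℂ V] : U × V →L[ℂ] U × V :=
  (0 : U →L[ℂ] U).prodMap (ContinuousLinearMap.id ℂ V)

/-- The block operator `[I 0; 0 B]` on `U × V` with domain `U × D(B)`. -/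
def blockA (B : V →ₗ.[ℂ] V) : U × V →ₗ.[ℂ] U × V where
  domain := (⊤ : Submodule ℂ U).prod B.domain
  toFun :=
    { toFun := fun w => ((w : U × V).1, B ⟨(w : U × V).2, w.2.2⟩)
      map_add' := fun w w' => Prod.ext rfl
        (B.map_add ⟨(w : U × V).2, w.2.2⟩ ⟨(w' : U × V).2, w'.2.2⟩)
      map_smul' := fun c w => Prod.ext rfl (B.map_smul c ⟨(w : U × V).2, w.2.2⟩) }

end Block

section Semigroup

variable {Y : Type*} [NormedAddCommGroup Y] [NormedSpace ℂ Y]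

/-- A strongly continuous semigroup of contractions. -/
structure IsContractionSemigroup (T : ℝ≥0 → Y →L[ℂ] Y) : Prop where
  map_zero : T 0 = ContinuousLinearMap.id ℂ Y
  map_add : ∀ s t : ℝ≥0, T (s + t) = (T s).comp (T t)
  tendsto_zero : ∀ y : Y, Tendsto (fun t : ℝ≥0 => T t y) (𝓝 0) (𝓝 y)
  norm_le : ∀ t : ℝ≥0, ‖T t‖ ≤ 1

/-- `B` is the infinitesimal generator of `T`: `x ∈ D(B)` and `B x = y` if and only if the
difference quotients `(T(t) x - x) / t` converge to `y` as `t ↓ 0`. -/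
def IsGenerator (B : Y →ₗ.[ℂ] Y) (T : ℝ≥0 → Y →L[ℂ] Y) : Prop :=
  ∀ x y : Y, (x, y) ∈ B.graph ↔
    Tendsto (fun t : ℝ≥0 => (((t : ℝ) : ℂ))⁻¹ • (T t x - x)) (𝓝[>] 0) (𝓝 y)

/-- `B` generates a (strongly continuous) contraction semigroup. -/
def GeneratesContractionSemigroup (B : Y →ₗ.[ℂ] Y) : Prop :=
  ∃ T : ℝ≥0 → Y →L[ℂ] Y, IsContractionSemigroup T ∧ IsGenerator B T

end Semigroup

end DAE

end

/-! For real `l > 0` in the resolvent set, testing the two dissipativity conditions on resolvent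
values shows that `T = R^E(l, A)` and `T = L^E(l, A)` both satisfy `l ‖T x‖² ≤ Re ⟪T x, x⟫`
(`rightResolvent_accretive`, `leftResolvent_accretive`). This inequality says exactly that `1 - 2lT`
is a contraction, so it passes to the adjoint. Two consequences carry the proof. First, `l ‖T‖ ≤ 1`,
so Neumann series extend the resolvent to all of `(0, ∞)`. Second, `T` and its adjoint have the same
kernel, so `(ran T)ᗮ = ker T` (`orthogonal_range_of_accretive`).

Hence `X¹ = (ker E)ᗮ` and `Z⁰ = (ran E)ᗮ`: both splittings are in fact orthogonal, and `P`, `Q` are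
orthogonal projections. The limits follow from the resolvent identity and the uniform bound on `s
R^E(s, A)` and `s L^E(s, A)`. `E₁` is a continuous bijection of Hilbert spaces, so the open mapping
theorem inverts it.

For the dynamics the key is `map_mem_Z1_iff`: on `D(A)`, `A x ∈ ran E` if and only if `x ∈ X¹`. A
derivative of `E x` stays in the closed subspace `ran E`, so a solution lies in `X¹`, where `E₁` can
be inverted. Finally, the resolvent of `E₁⁻¹ A₁` at `s` is the restriction of `R^E(s, A)` to `X¹`,
so the Hille–Yosida theorem for contractions, proved here by Yosida approximation, applies. -/

noncomputable section

namespace DAE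

/-! ### Exponentials in a Banach algebra. -/

section Exponential

variable {𝔸 : Type*} [NormedRing 𝔸] [NormedAlgebra ℝ 𝔸]

theorem exp_add_of_commute [CompleteSpace 𝔸] {x y : 𝔸} (h : Commute x y) :
    NormedSpace.exp (x + y) = NormedSpace.exp x * NormedSpace.exp y :=
  letI : NormedAlgebra ℚ 𝔸 := NormedAlgebra.restrictScalars ℚ ℝ 𝔸
  NormedSpace.exp_add_of_commute h

/-- The hypothesis is `‖1‖ ≤ 1` and not `‖1‖ = 1` so that operators on the zero space are covered;
`X¹` may be trivial. -/
theorem norm_exp_le (h1 : ‖(1 : 𝔸)‖ ≤ 1) (x : 𝔸) :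
    ‖NormedSpace.exp x‖ ≤ Real.exp ‖x‖ := by
  have hpow : ∀ n : ℕ, ‖x ^ n‖ ≤ ‖x‖ ^ n := fun n => by
    rcases Nat.eq_zero_or_pos n with rfl | hn
    · simpa using h1
    · exact norm_pow_le' x hn
  rw [NormedSpace.exp_eq_tsum ℝ, Real.exp_eq_exp_ℝ, NormedSpace.exp_eq_tsum ℝ]
  refine tsum_of_norm_bounded (NormedSpace.expSeries_summable' (𝕂 := ℝ) ‖x‖).hasSum fun n => ?_
  rw [norm_smul, Real.norm_of_nonneg (by positivity), smul_eq_mul]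
  gcongr
  exact hpow n

/-- The exponentials of the Yosida approximations are contractions. -/
theorem norm_exp_smul_sub_one_le [CompleteSpace 𝔸] (h1 : ‖(1 : 𝔸)‖ ≤ 1) {u : 𝔸} (hu : ‖u‖ ≤ 1) {c : ℝ}
    (hc : 0 ≤ c) : ‖NormedSpace.exp (c • (u - 1))‖ ≤ 1 := by
  have hcomm : Commute (c • u) (-c • (1 : 𝔸)) :=
    ((Commute.one_right u).smul_left c).smul_right (-c)
  have h2 : NormedSpace.exp (-c • (1 : 𝔸)) = Real.exp (-c) • (1 : 𝔸) := by
    have := NormedSpace.algebraMap_exp_comm (𝔸 := 𝔸) (-c)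
    rw [Algebra.algebraMap_eq_smul_one, Algebra.algebraMap_eq_smul_one] at this
    rw [← this, Real.exp_eq_exp_ℝ]
  have h3 : c • (u - 1) = c • u + -c • (1 : 𝔸) := by rw [smul_sub, neg_smul, sub_eq_add_neg]
  -- The scalar part splits off: `exp (c(u - 1)) = e^{-c} exp (cu)`, and `‖exp (cu)‖ ≤ e^c`.
  rw [h3, exp_add_of_commute hcomm, h2, mul_smul_comm, mul_one, norm_smul,
    Real.norm_of_nonneg (Real.exp_pos _).le]
  calc Real.exp (-c) * ‖NormedSpace.exp (c • u)‖
      ≤ Real.exp (-c) * Real.exp c := by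
        gcongr
        refine (norm_exp_le h1 _).trans (Real.exp_le_exp.2 ?_)
        rw [norm_smul, Real.norm_of_nonneg hc]
        exact mul_le_of_le_one_right hc hu
    _ = 1 := by rw [← Real.exp_add, neg_add_cancel, Real.exp_zero]

end Exponential

/-! ### Strong convergence from a dense set. -/

section Density

variable {Y : Type*} [NormedAddCommGroup Y] [NormedSpace ℂ Y]

/-- Uniformly bounded operators that converge on a dense set converge everywhere. -/
theorem cauchySeq_of_dense {T : ℕ → Y →L[ℂ] Y} (hT : ∀ n, ‖T n‖ ≤ 1) {s : Set Y}
    (hs : Dense s) (h : ∀ x ∈ s, CauchySeq fun n => T n x) (x : Y) :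
    CauchySeq fun n => T n x := by
  rw [Metric.cauchySeq_iff']
  intro ε hε
  obtain ⟨y, hy, hxy⟩ := hs.exists_dist_lt x (ε := ε / 3) (by positivity)
  obtain ⟨N, hN⟩ := Metric.cauchySeq_iff'.1 (h y hy) (ε / 3) (by positivity)
  refine ⟨N, fun n hn => ?_⟩
  have hd : ∀ m, dist (T m x) (T m y) < ε / 3 := fun m => by
    rw [dist_eq_norm, ← map_sub]
    refine ((T m).le_of_opNorm_le (hT m) _).trans_lt ?_
    rwa [one_mul, ← dist_eq_norm]
  have h1 := dist_triangle4 (T n x) (T n y) (T N y) (T N x)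
  have h2 := hd n
  have h3 := hd N
  rw [dist_comm] at h3
  linarith [hN n hn]

/-- Pointwise convergence to the limit extends from a dense set for contractions. -/
theorem tendsto_of_dense {ι : Type*} {l : Filter ι} {T : ι → Y →L[ℂ] Y} {S : Y →L[ℂ] Y}
    (hT : ∀ᶠ i in l, ‖T i‖ ≤ 1) (hS : ‖S‖ ≤ 1) {s : Set Y}
    (h : ∀ x ∈ s, Tendsto (fun i => T i x) l (𝓝 (S x))) {x : Y} (hx : x ∈ closure s) :
    Tendsto (fun i => T i x) l (𝓝 (S x)) := by
  rw [Metric.tendsto_nhds]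
  intro ε hε
  obtain ⟨y, hy, hxy⟩ := Metric.mem_closure_iff.1 hx (ε / 3) (by positivity)
  filter_upwards [hT, Metric.tendsto_nhds.1 (h y hy) (ε / 3) (by positivity)] with i hi hi'
  have hd : ∀ U : Y →L[ℂ] Y, ‖U‖ ≤ 1 → dist (U x) (U y) < ε / 3 := fun U hU => by
    rw [dist_eq_norm, ← map_sub]
    refine (U.le_of_opNorm_le hU _).trans_lt ?_
    rwa [one_mul, ← dist_eq_norm]
  have h1 := dist_triangle4 (T i x) (T i y) (S y) (S x)
  have h2 := hd _ hi
  have h3 := hd _ hS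
  rw [dist_comm] at h3
  linarith

end Density

/-! ### Estimates for contractive exponential groups. -/

section HilleYosida

variable {Y : Type*} [NormedAddCommGroup Y] [NormedSpace ℂ Y] [CompleteSpace Y]

theorem hasDerivAt_exp_smul_apply (C : Y →L[ℂ] Y) (x : Y) (t : ℝ) :
    HasDerivAt (fun r : ℝ => NormedSpace.exp (r • C) x) (NormedSpace.exp (t • C) (C x)) t := by
  have h := hasDerivAt_exp_smul_const (𝕂 := ℝ) C t
  exact (((ContinuousLinearMap.apply ℂ Y x).restrictScalars ℝ).hasFDerivAt.comp_hasDerivAt t h)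

/-- The curve `s ↦ exp(tD) exp(s(C - D)) x = exp(sC) exp((t-s)D) x` joins the two vectors as `s`
runs over `[0, t]`, and its speed is at most `‖(C - D) x‖`. -/
theorem norm_exp_smul_sub_exp_smul_le {C D : Y →L[ℂ] Y} (hCD : Commute C D)
    (hC : ∀ t : ℝ, 0 ≤ t → ‖NormedSpace.exp (t • C)‖ ≤ 1)
    (hD : ∀ t : ℝ, 0 ≤ t → ‖NormedSpace.exp (t • D)‖ ≤ 1) {t : ℝ} (ht : 0 ≤ t) (x : Y) :
    ‖NormedSpace.exp (t • C) x - NormedSpace.exp (t • D) x‖ ≤ t * ‖C x - D x‖ := by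
  have hmul : ∀ s : ℝ, NormedSpace.exp (t • D) * NormedSpace.exp (s • (C - D)) =
      NormedSpace.exp (s • C) * NormedSpace.exp ((t - s) • D) := fun s => by
    rw [← exp_add_of_commute, ← exp_add_of_commute]
    · congr 1
      rw [smul_sub, sub_smul]
      abel
    · exact (hCD.smul_left s).smul_right _
    · exact ((hCD.symm.sub_right (Commute.refl D)).smul_left t).smul_right s
  have hder : ∀ s : ℝ, HasDerivAt
      (fun r : ℝ => NormedSpace.exp (t • D) (NormedSpace.exp (r • (C - D)) x))
      (NormedSpace.exp (t • D) (NormedSpace.exp (s • (C - D)) ((C - D) x))) s := fun s =>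
    ((NormedSpace.exp (t • D)).restrictScalars ℝ).hasFDerivAt.comp_hasDerivAt s
      (hasDerivAt_exp_smul_apply (C - D) x s)
  have key := norm_image_sub_le_of_norm_deriv_le_segment' (a := 0) (b := t)
    (C := ‖C x - D x‖) (fun s _ => (hder s).hasDerivWithinAt) (fun s hs => ?_) t
    ⟨ht, le_rfl⟩
  · have e1 : NormedSpace.exp (t • D) (NormedSpace.exp (t • (C - D)) x) =
        NormedSpace.exp (t • C) x := by
      rw [← mul_apply_eq_comp, hmul t]
      simp
    have e2 : NormedSpace.exp (t • D) (NormedSpace.exp ((0 : ℝ) • (C - D)) x) =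
        NormedSpace.exp (t • D) x := by
      simp
    rw [e1, e2, sub_zero, mul_comm] at key
    exact key
  · rw [← mul_apply_eq_comp, hmul s, mul_apply_eq_comp,
      sub_apply]
    refine ((NormedSpace.exp (s • C)).le_of_opNorm_le (hC s hs.1) _).trans ?_
    rw [one_mul]
    refine ((NormedSpace.exp ((t - s) • D)).le_of_opNorm_le (hD _ (sub_nonneg.2 hs.2.le)) _).trans ?_
    rw [one_mul]

theorem norm_exp_smul_sub_le {C : Y →L[ℂ] Y}
    (hC : ∀ t : ℝ, 0 ≤ t → ‖NormedSpace.exp (t • C)‖ ≤ 1) {t : ℝ} (ht : 0 ≤ t) (x : Y) :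
    ‖NormedSpace.exp (t • C) x - x‖ ≤ t * ‖C x‖ := by
  simpa using norm_exp_smul_sub_exp_smul_le (Commute.zero_right C) hC
    (fun s _ => by
      simp only [smul_zero, NormedSpace.exp_zero]
      exact ContinuousLinearMap.norm_id_le) ht x

/-- A first-order expansion that survives the Yosida limit. The direct remainder would involve `C (C
x)`, which need not stay bounded along the approximations; replacing `C x` by a nearby `y` in the
domain of the generator leaves only `C y`, which does. -/
theorem norm_exp_smul_sub_sub_le {C : Y →L[ℂ] Y}
    (hC : ∀ t : ℝ, 0 ≤ t → ‖NormedSpace.exp (t • C)‖ ≤ 1) {t : ℝ} (ht : 0 ≤ t) (x y : Y) :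
    ‖NormedSpace.exp (t • C) x - x - t • C x‖ ≤ t * (2 * ‖C x - y‖ + t * ‖C y‖) := by
  have hder : ∀ s : ℝ, HasDerivAt (fun r : ℝ => NormedSpace.exp (r • C) x - r • C x)
      (NormedSpace.exp (s • C) (C x) - C x) s := fun s => by
    have h := (hasDerivAt_exp_smul_apply C x s).sub ((hasDerivAt_id s).smul_const (C x))
    rw [one_smul] at h
    exact h
  have key := norm_image_sub_le_of_norm_deriv_le_segment' (a := 0) (b := t)
    (C := 2 * ‖C x - y‖ + t * ‖C y‖) (fun s _ => (hder s).hasDerivWithinAt) (fun s hs => ?_) t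
    ⟨ht, le_rfl⟩
  · rw [sub_zero, mul_comm] at key
    simpa [sub_right_comm] using key
  · have e : NormedSpace.exp (s • C) (C x) - C x = NormedSpace.exp (s • C) (C x - y) +
        (NormedSpace.exp (s • C) y - y) - (C x - y) := by
      rw [map_sub]; abel
    rw [e]
    have h1 := (NormedSpace.exp (s • C)).le_of_opNorm_le (hC s hs.1) (C x - y)
    have h2 := norm_exp_smul_sub_le hC hs.1 y
    have h3 : s * ‖C y‖ ≤ t * ‖C y‖ := by gcongr; exact hs.2.le
    have h4 := norm_sub_le (NormedSpace.exp (s • C) (C x - y) +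
        (NormedSpace.exp (s • C) y - y)) (C x - y)
    have h5 := norm_add_le (NormedSpace.exp (s • C) (C x - y)) (NormedSpace.exp (s • C) y - y)
    linarith

end HilleYosida

/-! ### Algebra of pencil resolvents. -/

section Pencil

variable {X Z : Type*} [NormedAddCommGroup X] [NormedSpace ℂ X]
  [NormedAddCommGroup Z] [NormedSpace ℂ Z] {E : X →L[ℂ] Z} {A : X →ₗ.[ℂ] Z} {s t : ℂ}
  {S T : Z →L[ℂ] X}

namespace IsBoundedInverse

theorem mem_domain (hS : IsBoundedInverse (pencil E A s) S) (z : Z) : S z ∈ A.domain :=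
  (hS.2 z).1

theorem map_apply (hS : IsBoundedInverse (pencil E A s) S) (z : Z) :
    A ⟨S z, hS.mem_domain z⟩ = s • E (S z) - z := by
  obtain ⟨h, hz⟩ := hS.2 z
  change s • E (S z) - A ⟨S z, h⟩ = z at hz
  rw [eq_sub_iff_add_eq, add_comm]
  exact (sub_eq_iff_eq_add.1 hz).symm

theorem apply_sub (hS : IsBoundedInverse (pencil E A s) S) (x : A.domain) :
    S (s • E x - A x) = x :=
  hS.1 x

theorem of_apply (hl : ∀ x : A.domain, S (s • E x - A x) = x)
    (hr : ∀ z, ∃ h : S z ∈ A.domain, A ⟨S z, h⟩ = s • E (S z) - z) :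
    IsBoundedInverse (pencil E A s) S := by
  refine ⟨hl, fun z => ?_⟩
  obtain ⟨h, hz⟩ := hr z
  refine ⟨h, ?_⟩
  change s • E (S z) - A ⟨S z, h⟩ = z
  rw [hz, sub_sub_cancel]

/-- The resolvent identity. -/
theorem sub_eq (hS : IsBoundedInverse (pencil E A s) S)
    (hT : IsBoundedInverse (pencil E A t) T) (z : Z) :
    S z - T z = (t - s) • S (E (T z)) := by
  have h := hS.apply_sub ⟨T z, hT.mem_domain z⟩
  rw [hT.map_apply] at h
  change S (s • E (T z) - (t • E (T z) - z)) = T z at h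
  rw [map_sub, map_sub, map_smul, map_smul] at h
  rw [sub_eq_iff_eq_add, ← h, h, sub_smul]
  nth_rewrite 3 [← h]
  abel

end IsBoundedInverse

end Pencil

/-! ### The Hille–Yosida theorem for contractions. -/

section HilleYosida

variable {Y : Type*} [NormedAddCommGroup Y] [NormedSpace ℂ Y]

theorem commute_of_isBoundedInverse {B : Y →ₗ.[ℂ] Y} {s t : ℂ} {S T : Y →L[ℂ] Y}
    (hS : IsBoundedInverse (pencil (ContinuousLinearMap.id ℂ Y) B s) S)
    (hT : IsBoundedInverse (pencil (ContinuousLinearMap.id ℂ Y) B t) T) : Commute S T := by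
  by_cases hst : s = t
  · subst hst
    rw [hS.unique hT]
  · ext z
    have h1 := hS.sub_eq hT z
    have h2 := hT.sub_eq hS z
    have h3 : (t - s) • (S (T z) - T (S z)) = 0 := by
      rw [smul_sub, sub_eq_zero]
      calc (t - s) • S (T z) = S z - T z := h1.symm
        _ = -(T z - S z) := by abel
        _ = (t - s) • T (S z) := by
          rw [h2, ← neg_smul, neg_sub]
          rfl
    exact sub_eq_zero.1 ((smul_eq_zero.1 h3).resolve_left (sub_ne_zero.2 (Ne.symm hst)))

/-- The **Hille–Yosida theorem** for contraction semigroups. -/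
theorem generatesContractionSemigroup [CompleteSpace Y] {B : Y →ₗ.[ℂ] Y}
    (hB : Dense (B.domain : Set Y)) {R : ℝ → Y →L[ℂ] Y}
    (hR : ∀ s : ℝ, 0 < s → IsBoundedInverse (pencil (ContinuousLinearMap.id ℂ Y) B s) (R s))
    (hnorm : ∀ s : ℝ, 0 < s → s * ‖R s‖ ≤ 1) : GeneratesContractionSemigroup B := by
  have hinv : ∀ s : ℝ, 0 < s → ∀ x : B.domain, s • R s (x : Y) - x = R s (B x) :=
    fun s hs x => by
    have h : R s ((s : ℂ) • (x : Y) - B x) = x := (hR s hs).apply_sub x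
    rw [map_sub, map_smul, Complex.coe_smul, sub_eq_iff_eq_add] at h
    rw [h]; abel
  have h1 : ‖(1 : Y →L[ℂ] Y)‖ ≤ 1 := ContinuousLinearMap.norm_id_le
  set c : ℕ → ℝ := fun n => (n : ℝ) + 1 with hc
  have hc0 : ∀ n, 0 < c n := fun n => by positivity
  have hcu : ∀ n, ‖c n • R (c n)‖ ≤ 1 := fun n => by
    rw [norm_smul, Real.norm_of_nonneg (hc0 n).le]
    exact hnorm _ (hc0 n)
  -- The Yosida approximations `c²R(c) - c` of `B`, along `c = n + 1`, which is positive for every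
  -- `n`.
  set C : ℕ → Y →L[ℂ] Y := fun n => c n • (c n • R (c n) - 1) with hCdef
  have hC : ∀ n, ∀ t : ℝ, 0 ≤ t → ‖NormedSpace.exp (t • C n)‖ ≤ 1 := fun n t ht => by
    rw [hCdef, smul_smul]
    exact norm_exp_smul_sub_one_le h1 (hcu n) (mul_nonneg ht (hc0 n).le)
  have hcomm : ∀ n m, Commute (C n) (C m) := fun n m =>
    ((((((commute_of_isBoundedInverse (hR _ (hc0 n)) (hR _ (hc0 m))).smul_left _).smul_right
      _).sub_right (Commute.one_right _)).sub_left
        (Commute.one_left _)).smul_left _).smul_right _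
  -- On `D(B)` the approximation is `c R(c) B x`; since `c R(c)` tends strongly to the identity, it
  -- converges to `B x`.
  have hCdom : ∀ n (x : B.domain), C n x = (c n • R (c n)) (B x) := fun n x => by
    change c n • (c n • R (c n) (x : Y) - (x : Y)) = c n • R (c n) (B x)
    rw [hinv _ (hc0 n)]
  have hctop : Tendsto c atTop atTop := tendsto_atTop_add_const_right _ _ tendsto_natCast_atTop_atTop
  have hid : ∀ y : Y, Tendsto (fun n => (c n • R (c n)) y) atTop (𝓝 y) := fun y => by
    refine tendsto_of_dense (S := ContinuousLinearMap.id ℂ Y) (Eventually.of_forall hcu) h1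
      (s := B.domain) (fun x hx => ?_) (hB y)
    rw [tendsto_iff_norm_sub_tendsto_zero]
    have hlim : Tendsto (fun n => (c n)⁻¹ * ‖B ⟨x, hx⟩‖) atTop (𝓝 0) := by
      simpa using hctop.inv_tendsto_atTop.mul_const ‖B ⟨x, hx⟩‖
    refine squeeze_zero (fun _ => norm_nonneg _) (fun n => ?_) hlim
    change ‖c n • R (c n) x - x‖ ≤ _
    rw [hinv _ (hc0 n) ⟨x, hx⟩]
    refine (R (c n)).le_of_opNorm_le ?_ _
    rw [← one_div, le_div_iff₀' (hc0 n)]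
    exact hnorm _ (hc0 n)
  have hClim : ∀ x : B.domain, Tendsto (fun n => C n x) atTop (𝓝 (B x)) := fun x => by
    simp only [hCdom]
    exact hid _
  have hcauchy : ∀ (t : ℝ≥0) (x : Y), CauchySeq fun n => NormedSpace.exp ((t : ℝ) • C n) x :=
    fun t x => by
    refine cauchySeq_of_dense (fun n => hC n t t.2) hB (fun x hx => ?_) x
    have hcs := (hClim ⟨x, hx⟩).cauchySeq
    rw [Metric.cauchySeq_iff] at hcs ⊢
    intro ε hε
    obtain ⟨N, hN⟩ := hcs (ε / (t + 1)) (by positivity)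
    refine ⟨N, fun m hm n hn => ?_⟩
    have h2 := hN m hm n hn
    rw [dist_eq_norm] at h2 ⊢
    refine (norm_exp_smul_sub_exp_smul_le (hcomm m n) (hC m) (hC n) t.coe_nonneg x).trans_lt ?_
    rw [lt_div_iff₀ (by positivity)] at h2
    change ‖C m x - C n x‖ * _ < ε at h2
    nlinarith [norm_nonneg (C m x - C n x)]
  have hex : ∀ t : ℝ≥0, ∃ U : Y →L[ℂ] Y, ∀ x : Y,
      Tendsto (fun n => NormedSpace.exp ((t : ℝ) • C n) x) atTop (𝓝 (U x)) := fun t => by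
    choose f hf using fun x => cauchySeq_tendsto_of_complete (hcauchy t x)
    exact ⟨continuousLinearMapOfTendsto (fun n => NormedSpace.exp ((t : ℝ) • C n))
      (tendsto_pi_nhds.2 hf), hf⟩
  choose T hT using hex
  have hTle : ∀ t, ‖T t‖ ≤ 1 := fun t =>
    ContinuousLinearMap.opNorm_le_bound _ zero_le_one fun x =>
      le_of_tendsto (hT t x).norm (Eventually.of_forall fun n =>
        (NormedSpace.exp ((t : ℝ) • C n)).le_of_opNorm_le (hC n t t.2) x)
  have hTsub : ∀ (t : ℝ≥0) (x : B.domain), ‖T t x - x‖ ≤ t * ‖B x‖ := fun t x =>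
    le_of_tendsto_of_tendsto' ((hT t x).sub_const _).norm ((hClim x).norm.const_mul (t : ℝ))
      fun n => norm_exp_smul_sub_le (hC n) t.2 x
  have hTsub' : ∀ (t : ℝ≥0) (x y : B.domain),
      ‖T t x - x - (t : ℝ) • B x‖ ≤ t * (2 * ‖B x - y‖ + t * ‖B y‖) := fun t x y =>
    le_of_tendsto_of_tendsto'
      (((hT t x).sub_const _).sub ((hClim x).const_smul (t : ℝ))).norm
      ((((hClim x).sub_const (y : Y)).norm.const_mul 2).add
        ((hClim y).norm.const_mul (t : ℝ)) |>.const_mul (t : ℝ))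
      fun n => norm_exp_smul_sub_sub_le (hC n) t.2 x y
  have hgen : ∀ x : B.domain,
      Tendsto (fun t : ℝ≥0 => ((t : ℝ) : ℂ)⁻¹ • (T t x - x)) (𝓝[>] 0) (𝓝 (B x)) := fun x => by
    rw [Metric.tendsto_nhds]
    intro ε hε
    obtain ⟨y, hy, hxy⟩ := hB.exists_dist_lt (B x) (ε := ε / 4) (by positivity)
    have hlim : Tendsto (fun t : ℝ≥0 => (t : ℝ) * ‖B ⟨y, hy⟩‖) (𝓝[>] 0) (𝓝 0) := by
      have : Tendsto (fun t : ℝ≥0 => (t : ℝ) * ‖B ⟨y, hy⟩‖) (𝓝 0) (𝓝 ((0 : ℝ≥0) * ‖B ⟨y, hy⟩‖)) :=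
        (NNReal.continuous_coe.tendsto 0).mul_const _
      simpa using this.mono_left nhdsWithin_le_nhds
    filter_upwards [hlim.eventually_lt_const (half_pos hε), self_mem_nhdsWithin] with t ht ht0
    have ht0' : (0 : ℝ) < t := ht0
    have e : ((t : ℝ) : ℂ)⁻¹ • (T t x - x) - B x = (t : ℝ)⁻¹ • (T t x - x - (t : ℝ) • B x) := by
      rw [smul_sub _ (T t x - x : Y), inv_smul_smul₀ ht0'.ne', ← Complex.ofReal_inv, Complex.coe_smul]
    rw [dist_eq_norm, e, norm_smul, norm_inv, Real.norm_of_nonneg ht0'.le, inv_mul_lt_iff₀ ht0']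
    refine (hTsub' t x ⟨y, hy⟩).trans_lt ?_
    rw [dist_eq_norm] at hxy
    gcongr
    change 2 * ‖B x - y‖ + _ < ε
    linarith
  have hT0 : Tendsto (fun t : ℝ≥0 => (t : ℝ)) (𝓝 0) (𝓝 0) := NNReal.continuous_coe.tendsto 0
  refine ⟨T, ⟨?_, ?_, ?_, hTle⟩, ?_⟩
  · ext x
    refine tendsto_nhds_unique (hT 0 x) ?_
    simp
  · intro s t
    ext x
    refine tendsto_nhds_unique (hT (s + t) x) ?_
    have e : ∀ n, NormedSpace.exp (((s + t : ℝ≥0) : ℝ) • C n) x =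
        NormedSpace.exp ((s : ℝ) • C n) (NormedSpace.exp ((t : ℝ) • C n) x - T t x) +
          NormedSpace.exp ((s : ℝ) • C n) (T t x) := fun n => by
      rw [NNReal.coe_add, add_smul, exp_add_of_commute
        (((Commute.refl (C n)).smul_left _).smul_right _), map_sub, sub_add_cancel]
      rfl
    simp only [e]
    have h2 : Tendsto (fun n => NormedSpace.exp ((s : ℝ) • C n)
        (NormedSpace.exp ((t : ℝ) • C n) x - T t x)) atTop (𝓝 0) :=
      squeeze_zero_norm (fun n => by
        simpa only [one_mul] using
          (NormedSpace.exp ((s : ℝ) • C n)).le_of_opNorm_le (hC n s s.2) _)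
        (tendsto_iff_norm_sub_tendsto_zero.1 (hT t x))
    simpa using h2.add (hT s (T t x))
  · intro y
    refine tendsto_of_dense (S := ContinuousLinearMap.id ℂ Y) (Eventually.of_forall hTle) h1
      (s := B.domain) (fun x hx => ?_) (hB y)
    rw [tendsto_iff_norm_sub_tendsto_zero]
    exact squeeze_zero (fun _ => norm_nonneg _) (fun t => hTsub t ⟨x, hx⟩)
      (by simpa using hT0.mul_const ‖B ⟨x, hx⟩‖)
  · intro x y
    rw [LinearPMap.mem_graph_iff]
    refine ⟨?_, fun hxy => ?_⟩
    · rintro ⟨z, rfl, rfl⟩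
      exact hgen z
    -- The generator of `T` is no larger than `B`: solve `z - B z = x - y` in `D(B)`. Then the
    -- difference quotients of `T` at `w = x - z` converge to `w` itself, which contractivity
    -- permits only for `w = 0`.
    · obtain ⟨z, hz, hz'⟩ : ∃ (z : Y) (hz : z ∈ B.domain), B ⟨z, hz⟩ = z - (x - y) := by
        refine ⟨_, (hR 1 one_pos).mem_domain (x - y), ((hR 1 one_pos).map_apply _).trans ?_⟩
        rw [Complex.ofReal_one, one_smul]
        rfl
      have hw : Tendsto (fun t : ℝ≥0 => ((t : ℝ) : ℂ)⁻¹ • (T t (x - z) - (x - z))) (𝓝[>] 0)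
          (𝓝 (x - z)) := by
        have h2 := hxy.sub (hgen ⟨z, hz⟩)
        have e : y - B ⟨z, hz⟩ = x - z := by
          rw [hz']
          abel
        rw [e] at h2
        refine h2.congr fun t => ?_
        rw [← smul_sub, map_sub]
        congr 1
        abel
      have hle : ∀ᶠ t : ℝ≥0 in 𝓝[>] 0,
          ‖x - z‖ ≤ ‖((t : ℝ) : ℂ)⁻¹ • (T t (x - z) - (x - z)) - (x - z)‖ := by
        filter_upwards [self_mem_nhdsWithin] with t ht
        have ht0 : (0 : ℝ) < t := ht
        set w := x - z
        set q := ((t : ℝ) : ℂ)⁻¹ • (T t w - w) with hq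
        have e : (1 + (t : ℝ)) • w = T t w - (t : ℝ) • (q - w) := by
          have : (t : ℝ) • q = T t w - w := by
            rw [hq, ← Complex.ofReal_inv, Complex.coe_smul, smul_inv_smul₀ ht0.ne']
          rw [smul_sub (t : ℝ) q w, this, add_smul, one_smul]
          abel
        have h2 := norm_sub_le (T t w) ((t : ℝ) • (q - w))
        rw [← e, norm_smul, norm_smul, Real.norm_of_nonneg (by positivity),
          Real.norm_of_nonneg ht0.le] at h2
        have h3 := (T t).le_of_opNorm_le (hTle t) w
        have h4 : t * ‖w‖ ≤ t * ‖q - w‖ := by linarith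
        exact le_of_mul_le_mul_left h4 ht0
      have hle' := ge_of_tendsto (tendsto_iff_norm_sub_tendsto_zero.1 hw) hle
      have hxz : x = z := sub_eq_zero.1 (norm_le_zero_iff.1 hle')
      refine ⟨⟨z, hz⟩, hxz.symm, hz'.trans ?_⟩
      rw [hxz, sub_sub_cancel]

end HilleYosida

/-! ### Operators with `l ‖T x‖² ≤ Re ⟪T x, x⟫`. -/

section Accretive

variable {H : Type*} [NormedAddCommGroup H] [InnerProductSpace ℂ H]

theorem mul_norm_le_one_of_accretive {T : H →L[ℂ] H} {l : ℝ} (hl : 0 < l)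
    (h : ∀ x, l * ‖T x‖ ^ 2 ≤ (⟪T x, x⟫_ℂ).re) : l * ‖T‖ ≤ 1 := by
  rw [← le_div_iff₀' hl]
  refine ContinuousLinearMap.opNorm_le_bound _ (by positivity) fun x => ?_
  have h1 : l * ‖T x‖ ^ 2 ≤ ‖T x‖ * ‖x‖ := (h x).trans (re_inner_le_norm (𝕜 := ℂ) (T x) x)
  rcases (norm_nonneg (T x)).eq_or_lt with h0 | h0
  · rw [← h0]; positivity
  · rw [one_div, inv_mul_eq_div, le_div_iff₀' hl]
    exact le_of_mul_le_mul_left (by linarith) h0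

/-- This turns the accretivity inequality into `‖1 - 2lT‖ ≤ 1`, a condition visibly invariant under
taking adjoints. -/
theorem norm_sub_smul_sq (T : H →L[ℂ] H) (l : ℝ) (x : H) :
    ‖x - ((2 * l : ℝ) : ℂ) • T x‖ ^ 2 =
      ‖x‖ ^ 2 - 4 * l * ((⟪T x, x⟫_ℂ).re - l * ‖T x‖ ^ 2) := by
  have h : (⟪x, T x⟫_ℂ).re = (⟪T x, x⟫_ℂ).re := inner_re_symm (𝕜 := ℂ) x (T x)
  rw [norm_sub_sq (𝕜 := ℂ), inner_smul_right, norm_smul, Complex.norm_real, mul_pow,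
    Real.norm_eq_abs, sq_abs]
  simp only [RCLike.re_to_complex, Complex.re_ofReal_mul, h]
  ring

theorem accretive_adjoint [CompleteSpace H] {T : H →L[ℂ] H} {l : ℝ} (hl : 0 < l)
    (h : ∀ x, l * ‖T x‖ ^ 2 ≤ (⟪T x, x⟫_ℂ).re) (x : H) :
    l * ‖ContinuousLinearMap.adjoint T x‖ ^ 2 ≤ (⟪ContinuousLinearMap.adjoint T x, x⟫_ℂ).re := by
  set U : H →L[ℂ] H := ContinuousLinearMap.id ℂ H - ((2 * l : ℝ) : ℂ) • T with hU
  have hU1 : ‖U‖ ≤ 1 := by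
    refine ContinuousLinearMap.opNorm_le_bound _ zero_le_one fun y => ?_
    rw [one_mul]
    refine le_of_sq_le_sq ?_ (norm_nonneg _)
    change ‖y - ((2 * l : ℝ) : ℂ) • T y‖ ^ 2 ≤ _
    rw [norm_sub_smul_sq]
    have := mul_nonneg hl.le (sub_nonneg.2 (h y))
    linarith
  have hUadj : ContinuousLinearMap.adjoint U x =
      x - ((2 * l : ℝ) : ℂ) • ContinuousLinearMap.adjoint T x := by
    refine ext_inner_right ℂ fun y => ?_
    rw [ContinuousLinearMap.adjoint_inner_left, inner_sub_left, inner_smul_left,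
      ContinuousLinearMap.adjoint_inner_left]
    change ⟪x, y - ((2 * l : ℝ) : ℂ) • T y⟫_ℂ = _
    rw [inner_sub_right, inner_smul_right, Complex.conj_ofReal]
  have h1 : ‖ContinuousLinearMap.adjoint U x‖ ≤ 1 * ‖x‖ :=
    ContinuousLinearMap.le_of_opNorm_le _
      (by rwa [LinearIsometryEquiv.norm_map]) x
  rw [hUadj, one_mul] at h1
  have h2 := pow_le_pow_left₀ (norm_nonneg _) h1 2
  rw [norm_sub_smul_sq] at h2
  have h3 : 0 ≤ l * ((⟪ContinuousLinearMap.adjoint T x, x⟫_ℂ).re -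
    l * ‖ContinuousLinearMap.adjoint T x‖ ^ 2) := by linarith
  exact sub_nonneg.1 (nonneg_of_mul_nonneg_right h3 hl)

/-- If the adjoint kills `x`, then `⟪T x, x⟫ = 0`, and accretivity forces `T x = 0`. Since the
adjoint is accretive as well, the two kernels agree, and the kernel of the adjoint is `(ran T)ᗮ`. -/
theorem orthogonal_range_of_accretive [CompleteSpace H] {T : H →L[ℂ] H} {l : ℝ} (hl : 0 < l)
    (h : ∀ x, l * ‖T x‖ ^ 2 ≤ (⟪T x, x⟫_ℂ).re) :
    (LinearMap.range T.toLinearMap)ᗮ = LinearMap.ker T.toLinearMap := by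
  have h0 : ∀ U : H →L[ℂ] H, (∀ x, l * ‖U x‖ ^ 2 ≤ (⟪U x, x⟫_ℂ).re) → ∀ x,
      ContinuousLinearMap.adjoint U x = 0 → U x = 0 := fun U hU x hx => by
    have h1 := hU x
    rw [← ContinuousLinearMap.adjoint_inner_right, hx, inner_zero_right, Complex.zero_re] at h1
    have h2 : ‖U x‖ ^ 2 ≤ 0 := nonpos_of_mul_nonpos_right h1 hl
    exact norm_eq_zero.1 (pow_eq_zero_iff two_ne_zero |>.1 (h2.antisymm (sq_nonneg _)))
  refine T.orthogonal_range.trans (Submodule.ext fun x => ⟨h0 T h x, fun hx => ?_⟩)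
  refine h0 _ (accretive_adjoint hl h) x ?_
  rw [ContinuousLinearMap.adjoint_adjoint]
  exact hx

end Accretive

/-! ### Strong limits of `s F(s)` at infinity. -/

section PseudoResolvent

variable {H : Type*} [NormedAddCommGroup H] [NormedSpace ℂ H]

/-- On `ran F(l)` the resolvent identity gives `s F(s) F(l) y - F(l) y = F(s)(l F(l) y - y) =
O(1/s)`, and the uniform bound extends the convergence to the closure, which contains `P x`. The
remaining part `x - P x` is killed by `F(l)`, hence by every `F(s)`. -/
theorem tendsto_smul_pseudoResolvent {F : ℝ → H →L[ℂ] H} {l : ℝ}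
    (hnorm : ∀ s, 0 < s → s * ‖F s‖ ≤ 1)
    (hF : ∀ s, 0 < s → ∀ x, F s x - F l x = ((l : ℂ) - s) • F s (F l x)) {P : H →L[ℂ] H}
    (hP : ∀ x, P x ∈ closure (Set.range (F l))) (hker : ∀ x, F l (x - P x) = 0) (x : H) :
    Tendsto (fun s : ℝ => (s : ℂ) • F s x) atTop (𝓝 (P x)) := by
  have h1 : ∀ y ∈ Set.range (F l), Tendsto (fun s : ℝ => ((s : ℂ) • F s) y) atTop (𝓝 y) := by
    rintro _ ⟨y, rfl⟩
    rw [tendsto_iff_norm_sub_tendsto_zero]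
    have hlim : Tendsto (fun s : ℝ => s⁻¹ * ‖(l : ℂ) • F l y - y‖) atTop (𝓝 0) := by
      simpa using tendsto_inv_atTop_zero.mul_const ‖(l : ℂ) • F l y - y‖
    refine squeeze_zero' (Eventually.of_forall fun _ => norm_nonneg _) ?_ hlim
    filter_upwards [eventually_gt_atTop 0] with s hs
    have e : ((s : ℂ) • F s) (F l y) - F l y = F s ((l : ℂ) • F l y - y) := by
      have := hF s hs y
      rw [sub_smul, sub_eq_sub_iff_add_eq_add] at this
      rw [map_sub, map_smul, sub_eq_sub_iff_add_eq_add, add_comm, add_comm _ (F l y)]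
      change _ + (s : ℂ) • F s (F l y) = _
      rw [this, add_comm]
    rw [e]
    refine (F s).le_of_opNorm_le ?_ _
    rw [← one_div, le_div_iff₀' hs]
    exact hnorm s hs
  have h2 := tendsto_of_dense (T := fun s : ℝ => (s : ℂ) • F s) (S := ContinuousLinearMap.id ℂ H)
    (by
      filter_upwards [eventually_gt_atTop 0] with s hs
      rw [norm_smul, Complex.norm_real, Real.norm_of_nonneg hs.le]
      exact hnorm s hs) ContinuousLinearMap.norm_id_le h1 (hP x)
  refine h2.congr' ?_
  filter_upwards [eventually_gt_atTop 0] with s hs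
  have h3 := hF s hs (x - P x)
  rw [hker, map_zero, smul_zero, sub_zero, map_sub, sub_eq_zero] at h3
  change (s : ℂ) • F s (P x) = _
  rw [h3]

end PseudoResolvent

/-! ### Neumann series, kernels and ranges of the pencil resolvents. -/

section PencilNormed

variable {X Z : Type*} [NormedAddCommGroup X] [NormedSpace ℂ X]
  [NormedAddCommGroup Z] [NormedSpace ℂ Z] {E : X →L[ℂ] Z} {A : X →ₗ.[ℂ] Z} {s t : ℂ}
  {S T : Z →L[ℂ] X}

/-- The factorization `sE - A = (tE - A)(1 + (s - t) T E)` on `D(A)` reduces the claim to a Neumann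
series, with inverse `(1 + (s - t) T E)⁻¹ T`. -/
theorem IsBoundedInverse.mem_resolventSet [CompleteSpace X]
    (hT : IsBoundedInverse (pencil E A t) T) (h : ‖(s - t) • T.comp E‖ < 1) :
    s ∈ resolventSet E A := by
  obtain ⟨⟨U, V, hUV, hVU⟩, hU⟩ : IsUnit (1 + (s - t) • T.comp E) := by
    simpa using isUnit_one_sub_of_norm_lt_one (x := -((s - t) • T.comp E)) (by rwa [norm_neg])
  change U = _ at hU
  have hV1 : ∀ x, V (x + (s - t) • T (E x)) = x := fun x => by
    have := DFunLike.congr_fun hVU x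
    rwa [hU] at this
  have hV2 : ∀ x, V x + (s - t) • T (E (V x)) = x := fun x => by
    have := DFunLike.congr_fun hUV x
    rwa [hU] at this
  refine ⟨V.comp T, IsBoundedInverse.of_apply (fun x => ?_) fun z => ?_⟩
  · have e : T (s • E x - A x) = x + (s - t) • T (E x) := by
      calc T (s • E x - A x) = T (t • E x - A x) + (s - t) • T (E x) := by
            rw [← map_smul T, ← map_add T]
            congr 1
            rw [sub_smul]
            abel
        _ = x + (s - t) • T (E x) := by rw [hT.apply_sub x]
    rw [ContinuousLinearMap.comp_apply, e, hV1]
  -- Written as a value of `T`, the vector `V (T z)` is seen to lie in `D(A)`.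
  · have e : V (T z) = T (z - (s - t) • E (V (T z))) := by
      rw [map_sub, map_smul]
      exact eq_sub_of_add_eq (hV2 (T z))
    have hm := hT.map_apply (z - (s - t) • E (V (T z)))
    have hmem := hT.mem_domain (z - (s - t) • E (V (T z)))
    simp only [← e] at hm hmem
    refine ⟨hmem, hm.trans ?_⟩
    rw [sub_smul, ContinuousLinearMap.comp_apply]
    abel

theorem IsBoundedInverse.ker_eq (hS : IsBoundedInverse (pencil E A s) S) {z : Z} (hz : S z = 0) :
    z = 0 := by
  obtain ⟨h, hz'⟩ := hS.2 z
  rw [← hz']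
  have : (⟨S z, h⟩ : (pencil E A s).domain) = 0 := Subtype.ext hz
  rw [this, LinearPMap.map_zero]

theorem range_rightResolvent_le (hs : s ∈ resolventSet E A) (ht : t ∈ resolventSet E A) :
    LinearMap.range (rightResolvent E A t).toLinearMap ≤
      LinearMap.range (rightResolvent E A s).toLinearMap := by
  rintro _ ⟨x, rfl⟩
  refine ⟨x - (t - s) • rightResolvent E A t x, ?_⟩
  have h := (resolvent_spec hs).sub_eq (resolvent_spec ht) (E x)
  change resolvent E A s (E (x - (t - s) • resolvent E A t (E x))) = resolvent E A t (E x)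
  rw [map_sub, map_sub, map_smul, map_smul, ← h, sub_sub_cancel]

theorem X1_eq (hs : s ∈ resolventSet E A) (ht : t ∈ resolventSet E A) :
    X1 E A t = X1 E A s := by
  rw [X1, X1, (range_rightResolvent_le hs ht).antisymm (range_rightResolvent_le ht hs)]

/-- On `D(A) ∩ ker E` the pencil is `-A`, so the resolvent sends `A x` back to `-x`, which `E`
kills. -/
theorem Z0_eq_ker (hs : s ∈ resolventSet E A) :
    Z0 E A = LinearMap.ker (leftResolvent E A s).toLinearMap := by
  have hS := resolvent_spec hs
  ext z
  constructor
  · rintro ⟨x, hx, rfl⟩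
    have hx0 : E (x : X) = 0 := hx
    have h1 := hS.apply_sub x
    rw [hx0, smul_zero, zero_sub, map_neg, neg_eq_iff_eq_neg] at h1
    change E (resolvent E A s (A x)) = 0
    rw [h1, map_neg, hx0, neg_zero]
  · intro hz
    have hz0 : E (resolvent E A s z) = 0 := hz
    refine ⟨-⟨_, hS.mem_domain z⟩, ?_, ?_⟩
    · change E (-(resolvent E A s z)) = 0
      rw [map_neg, hz0, neg_zero]
    · change A (-⟨_, hS.mem_domain z⟩) = z
      rw [LinearPMap.map_neg, hS.map_apply, hz0, smul_zero, zero_sub, neg_neg]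

theorem ker_rightResolvent (hs : s ∈ resolventSet E A) :
    LinearMap.ker (rightResolvent E A s).toLinearMap = X0 E := by
  ext x
  refine ⟨fun hx => (resolvent_spec hs).ker_eq hx, fun hx => ?_⟩
  have hx0 : E x = 0 := hx
  change resolvent E A s (E x) = 0
  rw [hx0, map_zero]

end PencilNormed

/-! ### Dissipative pencils: the splittings, the operators `E₁`, `A₁`, and generation. -/

section DissipativePencil

variable {X Z : Type*}
    [NormedAddCommGroup X] [InnerProductSpace ℂ X] [CompleteSpace X]
    [NormedAddCommGroup Z] [InnerProductSpace ℂ Z] [CompleteSpace Z]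

/-- The standing hypotheses on the pencil `(E, A)`. -/
structure IsDissipativePencil (E : X →L[ℂ] Z) (A : X →ₗ.[ℂ] Z) : Prop where
  dense : Dense (A.domain : Set X)
  isClosed : A.IsClosed
  isClosed_range : IsClosed (Set.range E)
  exists_mem : ∃ l : ℝ, 0 < l ∧ (l : ℂ) ∈ DAE.resolventSet E A
  re_inner_le : ∀ x : A.domain, (⟪A x, E (x : X)⟫_ℂ).re ≤ 0
  re_inner_adjoint_le : ∀ z : A.adjoint.domain,
    (⟪A.adjoint z, ContinuousLinearMap.adjoint E (z : Z)⟫_ℂ).re ≤ 0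

namespace IsDissipativePencil

variable {E : X →L[ℂ] Z} {A : X →ₗ.[ℂ] Z} (h : IsDissipativePencil E A) {α : ℂ}
include h

/-- Dissipativity is tested at `x = (lE - A)⁻¹ z`, where `E x = L^E z` and `A x = l E x - z`. -/
theorem leftResolvent_accretive {l : ℝ} (hl : (l : ℂ) ∈ resolventSet E A) (z : Z) :
    l * ‖leftResolvent E A l z‖ ^ 2 ≤ (⟪leftResolvent E A l z, z⟫_ℂ).re := by
  have hS := resolvent_spec hl
  have h1 := h.re_inner_le ⟨_, hS.mem_domain z⟩
  rw [hS.map_apply] at h1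
  change (⟪(l : ℂ) • leftResolvent E A l z - z, leftResolvent E A l z⟫_ℂ).re ≤ 0 at h1
  rw [inner_sub_left, inner_smul_left, inner_self_eq_norm_sq_to_K, Complex.conj_ofReal,
    Complex.sub_re] at h1
  have h2 : (⟪z, leftResolvent E A l z⟫_ℂ).re = (⟪leftResolvent E A l z, z⟫_ℂ).re :=
    inner_re_symm (𝕜 := ℂ) _ _
  have h3 : ((l : ℂ) * ((‖leftResolvent E A l z‖ : ℝ) : ℂ) ^ 2).re =
      l * ‖leftResolvent E A l z‖ ^ 2 := by
    rw [← Complex.ofReal_pow, ← Complex.ofReal_mul, Complex.ofReal_re]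
  rw [h2] at h1
  erw [h3] at h1
  linarith

/-- The dual argument: the adjoint of `(lE - A)⁻¹` maps `x` to some `z ∈ D(A*)` with `A* z = l E* z
- x`. The condition on `A*` gives accretivity of the adjoint of `R^E`, which is then transferred
back. -/
theorem rightResolvent_accretive {l : ℝ} (hl0 : 0 < l) (hl : (l : ℂ) ∈ resolventSet E A) (x : X) :
    l * ‖rightResolvent E A l x‖ ^ 2 ≤ (⟪rightResolvent E A l x, x⟫_ℂ).re := by
  have hS := resolvent_spec hl
  rw [← ContinuousLinearMap.adjoint_adjoint (rightResolvent E A l)]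
  refine accretive_adjoint hl0 (fun x => ?_) x
  rw [rightResolvent, ContinuousLinearMap.adjoint_comp, ContinuousLinearMap.comp_apply]
  set z := ContinuousLinearMap.adjoint (resolvent E A l) x with hz
  set w := ContinuousLinearMap.adjoint E z with hw
  have hform : ∀ u : A.domain, ⟪(l : ℂ) • w - x, (u : X)⟫_ℂ = ⟪z, A u⟫_ℂ := fun u => by
    have h1 : ⟪x, (u : X)⟫_ℂ = ⟪z, (l : ℂ) • E u - A u⟫_ℂ := by
      rw [hz, ContinuousLinearMap.adjoint_inner_left, hS.apply_sub]
    rw [inner_sub_left, inner_smul_left, Complex.conj_ofReal, hw,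
      ContinuousLinearMap.adjoint_inner_left, h1, inner_sub_right, inner_smul_right]
    ring
  have hmem : z ∈ A.adjoint.domain := LinearPMap.mem_adjoint_domain_of_exists z ⟨_, hform⟩
  have h1 := h.re_inner_adjoint_le ⟨z, hmem⟩
  rw [LinearPMap.adjoint_apply_eq h.dense ⟨z, hmem⟩ hform] at h1
  change (⟪(l : ℂ) • w - x, w⟫_ℂ).re ≤ 0 at h1
  rw [inner_sub_left, inner_smul_left, inner_self_eq_norm_sq_to_K, Complex.conj_ofReal,
    Complex.sub_re] at h1
  have h2 : (⟪x, w⟫_ℂ).re = (⟪w, x⟫_ℂ).re := inner_re_symm (𝕜 := ℂ) _ _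
  have h3 : ((l : ℂ) * ((‖w‖ : ℝ) : ℂ) ^ 2).re = l * ‖w‖ ^ 2 := by
    rw [← Complex.ofReal_pow, ← Complex.ofReal_mul, Complex.ofReal_re]
  rw [h2] at h1
  erw [h3] at h1
  linarith

/-- Since `l ‖R^E(l, A)‖ ≤ 1`, the Neumann series around `l` converges for `|s - l| < l`. -/
theorem mem_resolventSet_of_lt {l : ℝ} (hl : (l : ℂ) ∈ resolventSet E A) {s : ℝ}
    (hs : 0 < s) (hsl : s < 2 * l) : (s : ℂ) ∈ resolventSet E A := by
  have hl0 : 0 < l := by linarith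
  refine (resolvent_spec hl).mem_resolventSet ?_
  have h1 : l * ‖rightResolvent E A l‖ ≤ 1 :=
    mul_norm_le_one_of_accretive hl0 (h.rightResolvent_accretive hl0 hl)
  rw [norm_smul, ← Complex.ofReal_sub, Complex.norm_real, Real.norm_eq_abs]
  change |s - l| * ‖rightResolvent E A l‖ < 1
  have h2 : |s - l| < l := abs_lt.2 ⟨by linarith, by linarith⟩
  rcases (norm_nonneg (rightResolvent E A l)).eq_or_lt with h0 | h0
  · rw [← h0, mul_zero]; exact one_pos
  · exact (mul_lt_mul_of_pos_right h2 h0).trans_le h1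

theorem mem_resolventSet {s : ℝ} (hs : 0 < s) : (s : ℂ) ∈ resolventSet E A := by
  obtain ⟨l, hl0, hl⟩ := h.exists_mem
  -- Any factor strictly between `1` and `2` would do: each step stays in the Neumann disc of the
  -- previous point, and the points tend to infinity.
  have hpow : ∀ n : ℕ, (((3 / 2 : ℝ) ^ n * l : ℝ) : ℂ) ∈ resolventSet E A := fun n => by
    induction n with
    | zero => simpa using hl
    | succ n ih =>
      have : 0 < (3 / 2 : ℝ) ^ n * l := by positivity
      exact h.mem_resolventSet_of_lt ih (by positivity) (by rw [pow_succ]; linarith)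
  obtain ⟨n, hn⟩ := pow_unbounded_of_one_lt (s / l) (by norm_num : (1 : ℝ) < 3 / 2)
  refine h.mem_resolventSet_of_lt (hpow n) hs ?_
  rw [div_lt_iff₀ hl0] at hn
  linarith

theorem mul_norm_rightResolvent_le {s : ℝ} (hs : 0 < s) : s * ‖rightResolvent E A s‖ ≤ 1 :=
  mul_norm_le_one_of_accretive hs (h.rightResolvent_accretive hs (h.mem_resolventSet hs))

theorem mul_norm_leftResolvent_le {s : ℝ} (hs : 0 < s) : s * ‖leftResolvent E A s‖ ≤ 1 :=
  mul_norm_le_one_of_accretive hs (h.leftResolvent_accretive (h.mem_resolventSet hs))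

theorem one_mem : (1 : ℂ) ∈ resolventSet E A := by
  simpa using h.mem_resolventSet one_pos
theorem X1_eq_orthogonal (hα : α ∈ resolventSet E A) : X1 E A α = (X0 E)ᗮ := by
  have h1 : ((1 : ℝ) : ℂ) ∈ resolventSet E A := h.mem_resolventSet one_pos
  rw [X1_eq h1 hα, X1, ← Submodule.orthogonal_orthogonal_eq_closure,
    orthogonal_range_of_accretive one_pos (h.rightResolvent_accretive one_pos h1),
    ker_rightResolvent h1]

theorem Z0_eq_orthogonal : Z0 E A = (Z1 E)ᗮ := by
  have h1 : ((1 : ℝ) : ℂ) ∈ resolventSet E A := h.mem_resolventSet one_pos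
  rw [Z0_eq_ker h1, ← orthogonal_range_of_accretive one_pos (h.leftResolvent_accretive h1)]
  refine le_antisymm (fun z hz => ?_) (Submodule.orthogonal_le ?_)
  -- The range of `L^E` is `E D(A)`; as `D(A)` is dense, a vector orthogonal to it is orthogonal to
  -- all of `ran E`.
  · have hcl : IsClosed {x : X | ⟪E x, z⟫_ℂ = 0} :=
      isClosed_eq (E.continuous.inner continuous_const) continuous_const
    have hsub : (A.domain : Set X) ⊆ {x : X | ⟪E x, z⟫_ℂ = 0} := fun x hx => by
      have hx' := (resolvent_spec h1).apply_sub ⟨x, hx⟩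
      have := (Submodule.mem_orthogonal _ _).1 hz _
        ⟨((1 : ℝ) : ℂ) • E x - A ⟨x, hx⟩, rfl⟩
      change ⟪E (resolvent E A _ (((1 : ℝ) : ℂ) • E x - A ⟨x, hx⟩)), z⟫_ℂ = 0 at this
      rwa [hx'] at this
    rw [Submodule.mem_orthogonal]
    rintro _ ⟨x, rfl⟩
    exact hcl.closure_subset_iff.2 hsub (h.dense x)
  · rintro _ ⟨z, rfl⟩
    exact ⟨_, rfl⟩

omit [CompleteSpace Z] h in
theorem hasOrthogonalProjection_X0 (E : X →L[ℂ] Z) : (X0 E).HasOrthogonalProjection :=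
  haveI : CompleteSpace (X0 E) := E.isClosed_ker.completeSpace_coe
  inferInstance

theorem completeSpace_Z1 : CompleteSpace (Z1 E) :=
  h.isClosed_range.completeSpace_coe

omit [CompleteSpace Z] h in
theorem completeSpace_X1 (E : X →L[ℂ] Z) (A : X →ₗ.[ℂ] Z) (α : ℂ) : CompleteSpace (X1 E A α) :=
  (Submodule.isClosed_topologicalClosure _).completeSpace_coe

theorem isCompl_X (hα : α ∈ resolventSet E A) : IsCompl (X0 E) (X1 E A α) := by
  have := hasOrthogonalProjection_X0 E
  rw [h.X1_eq_orthogonal hα]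
  exact (X0 E).isCompl_orthogonal

theorem isCompl_Z : IsCompl (Z0 E A) (Z1 E) := by
  have := h.completeSpace_Z1
  rw [h.Z0_eq_orthogonal]
  exact (Z1 E).isCompl_orthogonal.symm

theorem eq_zero_of_mem (hα : α ∈ resolventSet E A) {x : X} (hx : x ∈ X1 E A α) (hE : E x = 0) :
    x = 0 :=
  Submodule.disjoint_def.1 (h.isCompl_X hα).disjoint x hE hx

theorem exists_projection_X (hα : α ∈ resolventSet E A) : ∃ P : X →L[ℂ] X,
    (∀ x : X, Tendsto (fun s : ℝ => (s : ℂ) • rightResolvent E A s x) atTop (𝓝 (P x))) ∧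
      IsIdempotentElem P ∧
      LinearMap.range P.toLinearMap = X1 E A α ∧ LinearMap.ker P.toLinearMap = X0 E := by
  have := hasOrthogonalProjection_X0 E
  have h1 : ((1 : ℝ) : ℂ) ∈ resolventSet E A := h.mem_resolventSet one_pos
  refine ⟨(X0 E)ᗮ.starProjection, ?_, Submodule.isIdempotentElem_starProjection _, ?_, ?_⟩
  · refine tendsto_smul_pseudoResolvent (F := fun s => rightResolvent E A s) (l := 1)
      (fun s hs => h.mul_norm_rightResolvent_le hs)
      (fun s hs x => (resolvent_spec (h.mem_resolventSet hs)).sub_eq (resolvent_spec h1) (E x))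
      (fun x => ?_) (fun x => ?_)
    · have : (X0 E)ᗮ.starProjection x ∈ X1 E A ((1 : ℝ) : ℂ) := by
        rw [h.X1_eq_orthogonal h1]
        exact Submodule.starProjection_apply_mem _ x
      exact this
    · have : x - (X0 E)ᗮ.starProjection x ∈ (X0 E)ᗮᗮ :=
        Submodule.sub_starProjection_mem_orthogonal x
      rw [Submodule.orthogonal_orthogonal] at this
      exact (ker_rightResolvent h1).ge this
  · rw [h.X1_eq_orthogonal hα]
    exact Submodule.range_starProjection _
  · exact (Submodule.ker_starProjection _).trans (Submodule.orthogonal_orthogonal _)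

theorem exists_projection_Z : ∃ Q : Z →L[ℂ] Z,
    (∀ z : Z, Tendsto (fun s : ℝ => (s : ℂ) • leftResolvent E A s z) atTop (𝓝 (Q z))) ∧
      IsIdempotentElem Q ∧
      LinearMap.range Q.toLinearMap = Z1 E ∧ LinearMap.ker Q.toLinearMap = Z0 E A := by
  have := h.completeSpace_Z1
  have h1 : ((1 : ℝ) : ℂ) ∈ resolventSet E A := h.mem_resolventSet one_pos
  have hker := Z0_eq_ker h1
  rw [h.Z0_eq_orthogonal] at hker
  refine ⟨(Z1 E).starProjection, ?_, Submodule.isIdempotentElem_starProjection _,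
    Submodule.range_starProjection _,
    (Submodule.ker_starProjection _).trans h.Z0_eq_orthogonal.symm⟩
  refine tendsto_smul_pseudoResolvent (F := fun s => leftResolvent E A s) (l := 1)
    (fun s hs => h.mul_norm_leftResolvent_le hs) (fun s hs z => ?_) (fun z => ?_) (fun z => ?_)
  · have := (resolvent_spec (h.mem_resolventSet hs)).sub_eq (resolvent_spec h1) z
    change E _ - E _ = _ • E _
    rw [← map_sub E]
    exact (congrArg E this).trans (map_smul E _ _)
  · have hz : (Z1 E).starProjection z ∈ (Z1 E)ᗮᗮ := by
      rw [Submodule.orthogonal_orthogonal]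
      exact Submodule.starProjection_apply_mem _ z
    rw [hker, ← orthogonal_range_of_accretive one_pos (h.leftResolvent_accretive h1),
      Submodule.orthogonal_orthogonal_eq_closure] at hz
    exact hz
  · have : z - (Z1 E).starProjection z ∈ (Z1 E)ᗮ := Submodule.sub_starProjection_mem_orthogonal z
    rw [hker] at this
    exact this

theorem isInvertible_E1 (hα : α ∈ resolventSet E A) : (E1 E A α).IsInvertible := by
  have := h.completeSpace_Z1
  have := completeSpace_X1 E A α
  refine ⟨ContinuousLinearEquiv.ofBijective (E1 E A α) ?_ ?_,
    ContinuousLinearEquiv.coe_ofBijective _ _ _⟩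
  · refine LinearMap.ker_eq_bot'.2 fun x hx => Subtype.ext ?_
    exact h.eq_zero_of_mem hα x.2 (congrArg Subtype.val hx)
  · refine LinearMap.range_eq_top.2 fun z => ?_
    obtain ⟨x, hx⟩ := z.2
    obtain ⟨x0, hx0, x1, hx1, rfl⟩ := Submodule.mem_sup.1
      ((h.isCompl_X hα).sup_eq_top.symm ▸ Submodule.mem_top : x ∈ X0 E ⊔ X1 E A α)
    refine ⟨⟨x1, hx1⟩, Subtype.ext ?_⟩
    have hx0' : E x0 = 0 := hx0
    change E (x0 + x1) = z at hx
    rw [map_add, hx0', zero_add] at hx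
    exact hx

/-- If `A x = E w`, then `x = R^E(α)(αx - w)`. Conversely, split `(αE - A) x = z₀ + E w` along `Z⁰ ⊕
Z¹`: for `x ∈ X¹` the vector `(αE - A)⁻¹ z₀` lies in both `X¹` and `ker E`, so `z₀ = 0`. -/
theorem map_mem_Z1_iff (hα : α ∈ resolventSet E A) (x : A.domain) :
    A x ∈ Z1 E ↔ (x : X) ∈ X1 E A α := by
  have hS := resolvent_spec hα
  have hR : ∀ w, resolvent E A α (E w) ∈ X1 E A α := fun w =>
    Submodule.le_topologicalClosure _ ⟨w, rfl⟩
  have hx := hS.apply_sub x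
  constructor
  · rintro ⟨w, hw⟩
    change E w = A x at hw
    rw [← hx, ← hw, ← map_smul, ← map_sub]
    exact hR _
  · intro hx1
    obtain ⟨z0, hz0, z1, ⟨w, rfl⟩, hz⟩ := Submodule.mem_sup.1
      (h.isCompl_Z.sup_eq_top.symm ▸ Submodule.mem_top : α • E x - A x ∈ Z0 E A ⊔ Z1 E)
    change z0 + E w = _ at hz
    rw [← hz, map_add] at hx
    rw [Z0_eq_ker hα] at hz0
    have h0 : resolvent E A α z0 = 0 := by
      refine h.eq_zero_of_mem hα ?_ hz0
      rw [eq_sub_of_add_eq hx]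
      exact Submodule.sub_mem _ hx1 (hR w)
    rw [hS.ker_eq h0, zero_add] at hz
    refine ⟨α • (x : X) - w, ?_⟩
    change E (α • (x : X) - w) = A x
    rw [map_sub, map_smul, hz, sub_sub_cancel]

theorem map_mem_Z1 (hα : α ∈ resolventSet E A) (x : A.domain) (hx : (x : X) ∈ X1 E A α) :
    A x ∈ Z1 E :=
  (h.map_mem_Z1_iff hα x).2 hx

omit [CompleteSpace X] [CompleteSpace Z] h in
theorem dense_domain_A1 (hα : α ∈ resolventSet E A)
    (hm : ∀ x : A.domain, (x : X) ∈ X1 E A α → A x ∈ Z1 E) :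
    Dense ((A1 E A α hm).domain : Set (X1 E A α)) := by
  intro x
  rw [IsInducing.subtypeVal.closure_eq_preimage_closure_image]
  have hx : (x : X) ∈ closure (Set.range (rightResolvent E A α)) := x.2
  refine closure_mono ?_ hx
  rintro _ ⟨w, rfl⟩
  exact ⟨⟨_, Submodule.le_topologicalClosure _ ⟨w, rfl⟩⟩,
    (resolvent_spec hα).mem_domain (E w), rfl⟩

theorem isClosed_A1 (hm : ∀ x : A.domain, (x : X) ∈ X1 E A α → A x ∈ Z1 E) :
    (A1 E A α hm).IsClosed := by
  have hc : Continuous fun p : X1 E A α × Z1 E => ((p.1 : X), (p.2 : Z)) := by fun_prop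
  have e : ((A1 E A α hm).graph : Set (X1 E A α × Z1 E)) =
      (fun p : X1 E A α × Z1 E => ((p.1 : X), (p.2 : Z))) ⁻¹' (A.graph : Set (X × Z)) := by
    ext ⟨x, z⟩
    simp only [SetLike.mem_coe, Set.mem_preimage, LinearPMap.mem_graph_iff]
    constructor
    · rintro ⟨y, rfl, rfl⟩
      exact ⟨⟨_, y.2⟩, rfl, rfl⟩
    · rintro ⟨y, hy, hz⟩
      refine ⟨⟨x, ?_⟩, rfl, Subtype.ext ?_⟩
      · change (x : X) ∈ A.domain
        rw [← hy]
        exact y.2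
      · change A ⟨(x : X), _⟩ = z
        rw [← hz]
        congr 1
        exact Subtype.ext hy.symm
  rw [LinearPMap.IsClosed, e]
  exact h.isClosed.preimage hc

theorem map_E1invA1 (hα : α ∈ resolventSet E A)
    (hm : ∀ x : A.domain, (x : X) ∈ X1 E A α → A x ∈ Z1 E) (x : (E1invA1 E A α hm).domain) :
    E (E1invA1 E A α hm x : X) = A ⟨((x : X1 E A α) : X), x.2⟩ :=
  congrArg Subtype.val ((h.isInvertible_E1 hα).self_apply_inverse (A1 E A α hm x))

theorem generates (hα : α ∈ resolventSet E A)
    (hm : ∀ x : A.domain, (x : X) ∈ X1 E A α → A x ∈ Z1 E) :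
    GeneratesContractionSemigroup (E1invA1 E A α hm) := by
  have := completeSpace_X1 E A α
  have hmem : ∀ s : ℝ, 0 < s → ∀ x, rightResolvent E A s x ∈ X1 E A α := fun s hs x => by
    rw [← X1_eq hα (h.mem_resolventSet hs)]
    exact Submodule.le_topologicalClosure _ ⟨x, rfl⟩
  -- `R s` is `R^E(s, A)` restricted to the invariant subspace `X¹`; its value for `s ≤ 0` plays no
  -- role.
  have hex : ∀ s : ℝ, ∃ R : X1 E A α →L[ℂ] X1 E A α,
      0 < s → ∀ x, (R x : X) = rightResolvent E A s x := fun s => by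
    by_cases hs : 0 < s
    · exact ⟨((rightResolvent E A s).comp (X1 E A α).subtypeL).codRestrict _
        (fun x => hmem s hs x), fun _ _ => rfl⟩
    · exact ⟨0, fun h' => absurd h' hs⟩
  choose R hR using hex
  refine generatesContractionSemigroup (dense_domain_A1 hα hm) (R := R) (fun s hs => ?_)
    (fun s hs => ?_)
  · have hS := resolvent_spec (h.mem_resolventSet hs)
    refine IsBoundedInverse.of_apply (fun x => Subtype.ext ?_) (fun y => ?_)
    · rw [hR s hs]
      change resolvent E A s (E ((s : ℂ) • ((x : X1 E A α) : X) - (E1invA1 E A α hm x : X))) = _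
      rw [map_sub, map_smul, h.map_E1invA1 hα]
      exact hS.apply_sub ⟨((x : X1 E A α) : X), x.2⟩
    · have hmem' : (R s y : X) ∈ A.domain := by
        rw [hR s hs]
        exact hS.mem_domain _
      refine ⟨hmem', Subtype.ext (sub_eq_zero.1 (h.eq_zero_of_mem hα
        (Submodule.sub_mem _ (Subtype.mem _) (Subtype.mem _)) ?_))⟩
      rw [map_sub, h.map_E1invA1 hα, sub_eq_zero]
      change _ = E ((s : ℂ) • (R s y : X) - y)
      rw [map_sub, map_smul]
      simp only [hR s hs]
      exact hS.map_apply _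
  · refine le_trans ?_ (h.mul_norm_rightResolvent_le hs)
    gcongr
    refine ContinuousLinearMap.opNorm_le_bound _ (norm_nonneg _) fun x => ?_
    change ‖(R s x : X)‖ ≤ _ * ‖(x : X)‖
    rw [hR s hs]
    exact (rightResolvent E A s).le_opNorm x

/-- `E₁⁻¹` composed with the orthogonal projection onto `Z¹`. Being bounded on all of `Z`, it
carries derivatives and continuity from `E x` and `A x` back to `X¹`. -/
theorem exists_leftInverse (hα : α ∈ resolventSet E A) :
    ∃ G : Z →L[ℂ] X1 E A α, ∀ x : X1 E A α, G (E x) = x := by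
  have := h.completeSpace_Z1
  refine ⟨(E1 E A α).inverse.comp (Z1 E).orthogonalProjectionOnto, fun x => ?_⟩
  rw [ContinuousLinearMap.comp_apply]
  have e : (Z1 E).orthogonalProjectionOnto (E x) = E1 E A α x :=
    Submodule.orthogonalProjectionOnto_mem_subspace_eq_self (E1 E A α x)
  rw [e, (h.isInvertible_E1 hα).inverse_apply_self]

end IsDissipativePencil

/-- `w` solves `dw/dt = B w` on `J`. -/
def IsODESolution {Y : Type*} [NormedAddCommGroup Y] [NormedSpace ℂ Y] (B : Y →ₗ.[ℂ] Y)
    (J : Set ℝ) (w : ℝ → Y) : Prop :=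
  ∀ t ∈ J, ∃ ht : w t ∈ B.domain, HasDerivWithinAt w (B ⟨w t, ht⟩) J t

theorem uniqueDiffOn_of_ordConnected {J : Set ℝ} (hJ : J.OrdConnected) (hJ' : J.Nontrivial) :
    UniqueDiffOn ℝ J :=
  uniqueDiffOn_convex hJ.convex (hJ.convex.nontrivial_iff_nonempty_interior.1 hJ')

/-! ### Equivalence of the two evolution equations. -/

section Solutions

theorem hasDerivWithinAt_map {V W : Type*} [NormedAddCommGroup V] [NormedSpace ℂ V]
    [NormedAddCommGroup W] [NormedSpace ℂ W] (G : V →L[ℂ] W) {f : ℝ → V} {f' : V} {J : Set ℝ}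
    {t : ℝ} (hf : HasDerivWithinAt f f' J t) :
    HasDerivWithinAt (fun r => G (f r)) (G f') J t :=
  (G.restrictScalars ℝ).hasFDerivAt.comp_hasDerivWithinAt t hf

/-- Pairing with any vector of `pᗮ` gives the zero function, whose derivative within `J` can only be
zero. -/
theorem deriv_mem_of_forall_mem {H : Type*} [NormedAddCommGroup H] [InnerProductSpace ℂ H]
    (p : Submodule ℂ H) [p.HasOrthogonalProjection] {f : ℝ → H} {f' : H} {J : Set ℝ} {t : ℝ}
    (hJ : UniqueDiffWithinAt ℝ J t) (hf : HasDerivWithinAt f f' J t) (hp : ∀ r, f r ∈ p) :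
    f' ∈ p := by
  rw [← p.orthogonal_orthogonal, Submodule.mem_orthogonal]
  intro z hz
  have h1 := hasDerivWithinAt_map (innerSL ℂ z) hf
  have h2 : (fun r => innerSL ℂ z (f r)) = fun _ => 0 := funext fun r =>
    Submodule.inner_left_of_mem_orthogonal (hp r) hz
  rw [h2] at h1
  exact hJ.eq_deriv _ h1 (hasDerivWithinAt_const t J (0 : ℂ))

theorem isSolution_block_iff {U V : Type*} [NormedAddCommGroup U] [NormedSpace ℂ U]
    [NormedAddCommGroup V] [NormedSpace ℂ V] {B : V →ₗ.[ℂ] V} {J : Set ℝ}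
    (hJ : UniqueDiffOn ℝ J) {x0 : ℝ → U} {x1 : ℝ → V} :
    IsSolution (blockE U V) (blockA U B) J (fun t => (x0 t, x1 t)) ↔
      (∀ t ∈ J, x0 t = 0) ∧ IsODESolution B J x1 := by
  constructor
  · intro hs
    have hx : ∀ t ∈ J, x0 t = 0 ∧ ∃ ht : x1 t ∈ B.domain,
        HasDerivWithinAt x1 (B ⟨x1 t, ht⟩) J t := fun t ht => by
      obtain ⟨hd, hder⟩ := hs t ht
      have h0 := hasDerivWithinAt_map (ContinuousLinearMap.fst ℂ U V) hder
      have h1 := hasDerivWithinAt_map (ContinuousLinearMap.snd ℂ U V) hder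
      -- The first component of the left side is constantly `0`, so uniqueness of the derivative
      -- turns the first row into `x⁰ = 0`.
      exact ⟨(hJ t ht).eq_deriv _ h0 (hasDerivWithinAt_const t J (0 : U)), hd.2, h1⟩
    exact ⟨fun t ht => (hx t ht).1, fun t ht => (hx t ht).2⟩
  · rintro ⟨h0, h1⟩ t ht
    obtain ⟨hd, hder⟩ := h1 t ht
    refine ⟨⟨Submodule.mem_top, hd⟩, ?_⟩
    have h2 := hasDerivWithinAt_map (ContinuousLinearMap.inr ℂ U V) hder
    have e : blockA U B ⟨(x0 t, x1 t), ⟨Submodule.mem_top, hd⟩⟩ = (0, B ⟨x1 t, hd⟩) :=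
      Prod.ext (h0 t ht) rfl
    rw [e]
    exact h2

theorem isClassicalSolution_block_iff {U V : Type*} [NormedAddCommGroup U] [NormedSpace ℂ U]
    [NormedAddCommGroup V] [NormedSpace ℂ V] {B : V →ₗ.[ℂ] V} {J : Set ℝ}
    (hJ : UniqueDiffOn ℝ J) {x0 : ℝ → U} {x1 : ℝ → V} :
    IsClassicalSolution (blockE U V) (blockA U B) J (fun t => (x0 t, x1 t)) ↔
      ((∀ t ∈ J, x0 t = 0) ∧ IsODESolution B J x1) ∧
        ∃ y : ℝ → V, ContinuousOn y J ∧ ∀ t ∈ J, ∃ ht : x1 t ∈ B.domain, B ⟨x1 t, ht⟩ = y t := by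
  rw [IsClassicalSolution, isSolution_block_iff hJ]
  refine and_congr_right fun hx => ⟨?_, ?_⟩
  · rintro ⟨y, hy, hy'⟩
    refine ⟨fun t => (y t).2, continuous_snd.comp_continuousOn hy, fun t ht => ?_⟩
    obtain ⟨hd, he⟩ := hy' t ht
    exact ⟨hd.2, congrArg Prod.snd he⟩
  · rintro ⟨y, hy, hy'⟩
    refine ⟨fun t => (0, y t), continuousOn_const.prodMk hy, fun t ht => ?_⟩
    obtain ⟨hd, he⟩ := hy' t ht
    exact ⟨⟨Submodule.mem_top, hd⟩, Prod.ext (hx.1 t ht) he⟩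

variable {E : X →L[ℂ] Z} {A : X →ₗ.[ℂ] Z} (h : IsDissipativePencil E A) {α : ℂ}
  (hα : α ∈ resolventSet E A) (hm : ∀ x : A.domain, (x : X) ∈ X1 E A α → A x ∈ Z1 E)
  {J : Set ℝ} {x0 : ℝ → X0 E} {x1 : ℝ → X1 E A α}
include h hα

theorem IsDissipativePencil.isSolution_iff (hJ : UniqueDiffOn ℝ J) :
    IsSolution E A J (fun t => (x0 t : X) + (x1 t : X)) ↔
      (∀ t ∈ J, x0 t = 0) ∧ IsODESolution (E1invA1 E A α hm) J x1 := by
  have hE : ∀ t, E ((x0 t : X) + (x1 t : X)) = E (x1 t) := fun t => by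
    have h0 : E (x0 t : X) = 0 := (x0 t).2
    rw [map_add, h0, zero_add]
  simp only [IsSolution, hE]
  constructor
  · intro hs
    obtain ⟨G, hG⟩ := h.exists_leftInverse hα
    have := h.completeSpace_Z1
    have hx : ∀ t ∈ J, x0 t = 0 ∧ ∃ ht : x1 t ∈ (E1invA1 E A α hm).domain,
        HasDerivWithinAt x1 (E1invA1 E A α hm ⟨x1 t, ht⟩) J t := fun t ht => by
      obtain ⟨hd, hder⟩ := hs t ht
      -- The decisive step: `A x(t)` is a derivative of a curve in the closed subspace `ran E`,
      -- which forces `x(t) ∈ X¹` and so `x⁰(t) = 0`.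
      have h4 : A ⟨_, hd⟩ ∈ Z1 E :=
        deriv_mem_of_forall_mem (Z1 E) (hJ t ht) hder fun r => ⟨(x1 r : X), rfl⟩
      have h5 : (x0 t : X) + x1 t ∈ X1 E A α := (h.map_mem_Z1_iff hα _).1 h4
      have h6 : (x0 t : X) = 0 := by
        refine h.eq_zero_of_mem hα ?_ (x0 t).2
        simpa using Submodule.sub_mem _ h5 (x1 t).2
      have h7 : (x0 t : X) + x1 t = x1 t := by rw [h6, zero_add]
      simp only [h7] at hd hder
      refine ⟨Subtype.ext h6, hd, ?_⟩
      have h8 := hasDerivWithinAt_map G hder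
      rw [← h.map_E1invA1 hα hm ⟨x1 t, hd⟩] at h8
      simp only [hG] at h8
      exact h8
    exact ⟨fun t ht => (hx t ht).1, fun t ht => (hx t ht).2⟩
  · rintro ⟨h0, h1⟩ t ht
    obtain ⟨hd, hder⟩ := h1 t ht
    have h7 : (x0 t : X) + x1 t = x1 t := by rw [h0 t ht, Submodule.coe_zero, zero_add]
    simp only [h7]
    refine ⟨hd, ?_⟩
    have h8 := hasDerivWithinAt_map (E.comp (X1 E A α).subtypeL) hder
    exact h8.congr_deriv (h.map_E1invA1 hα hm ⟨x1 t, hd⟩)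

theorem IsDissipativePencil.isClassicalSolution_iff (hJ : UniqueDiffOn ℝ J) :
    IsClassicalSolution E A J (fun t => (x0 t : X) + (x1 t : X)) ↔
      ((∀ t ∈ J, x0 t = 0) ∧ IsODESolution (E1invA1 E A α hm) J x1) ∧
        ∃ y : ℝ → X1 E A α, ContinuousOn y J ∧
          ∀ t ∈ J, ∃ ht : x1 t ∈ (E1invA1 E A α hm).domain, E1invA1 E A α hm ⟨x1 t, ht⟩ = y t := by
  rw [IsClassicalSolution, h.isSolution_iff hα hm hJ]
  refine and_congr_right fun hx => ?_
  have h7 : ∀ t ∈ J, (x0 t : X) + x1 t = x1 t := fun t ht => by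
    rw [hx.1 t ht, Submodule.coe_zero, zero_add]
  constructor
  · rintro ⟨y, hy, hy'⟩
    obtain ⟨G, hG⟩ := h.exists_leftInverse hα
    refine ⟨fun t => G (y t), G.continuous.comp_continuousOn hy, fun t ht => ?_⟩
    obtain ⟨hd, he⟩ := hy' t ht
    simp only [h7 t ht] at hd he
    refine ⟨hd, ?_⟩
    change _ = G (y t)
    rw [← he, ← h.map_E1invA1 hα hm ⟨x1 t, hd⟩, hG]
  · rintro ⟨y, hy, hy'⟩
    refine ⟨fun t => E (y t), (E.comp (X1 E A α).subtypeL).continuous.comp_continuousOn hy,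
      fun t ht => ?_⟩
    obtain ⟨hd, he⟩ := hy' t ht
    simp only [h7 t ht]
    exact ⟨hd, by rw [← he, h.map_E1invA1 hα hm ⟨x1 t, hd⟩]⟩

end Solutions
end DissipativePencil

end DAE

end

theorem mainTheorem1
    {X Z : Type*}
    [NormedAddCommGroup X] [InnerProductSpace ℂ X] [CompleteSpace X]
    [NormedAddCommGroup Z] [InnerProductSpace ℂ Z] [CompleteSpace Z]
    (E : X →L[ℂ] Z) (A : X →ₗ.[ℂ] Z)
    (hA_dense : Dense (A.domain : Set X)) (hA_closed : A.IsClosed)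
    (hE : IsClosed (Set.range E))
    (hres : ∃ l : ℝ, 0 < l ∧ (l : ℂ) ∈ DAE.resolventSet E A)
    (hdiss : ∀ x : A.domain, (⟪A x, E (x : X)⟫_ℂ).re ≤ 0)
    (hdiss_adj : ∀ z : A.adjoint.domain,
      (⟪A.adjoint z, ContinuousLinearMap.adjoint E (z : Z)⟫_ℂ).re ≤ 0)
    (α : ℂ) (hα : α ∈ DAE.resolventSet E A) :
    -- the splittings, and independence of `α`
    (∀ β ∈ DAE.resolventSet E A, DAE.X1 E A β = DAE.X1 E A α) ∧
    IsCompl (DAE.X0 E) (DAE.X1 E A α) ∧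
    IsCompl (DAE.Z0 E A) (DAE.Z1 E) ∧
    -- the resolvents `R^E(s, A)` and `L^E(s, A)` exist for all real `s > 0`
    (∀ s : ℝ, 0 < s → (s : ℂ) ∈ DAE.resolventSet E A) ∧
    -- the projection `P`
    (∃ P : X →L[ℂ] X,
      (∀ x : X, Tendsto (fun s : ℝ => (s : ℂ) • DAE.rightResolvent E A s x) atTop (𝓝 (P x))) ∧
      IsIdempotentElem P ∧
      LinearMap.range P.toLinearMap = DAE.X1 E A α ∧
      LinearMap.ker P.toLinearMap = DAE.X0 E) ∧
    -- the projection `Q`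
    (∃ Q : Z →L[ℂ] Z,
      (∀ z : Z, Tendsto (fun s : ℝ => (s : ℂ) • DAE.leftResolvent E A s z) atTop (𝓝 (Q z))) ∧
      IsIdempotentElem Q ∧
      LinearMap.range Q.toLinearMap = DAE.Z1 E ∧
      LinearMap.ker Q.toLinearMap = DAE.Z0 E A) ∧
    -- `E₁` is boundedly invertible
    (DAE.E1 E A α).IsInvertible ∧
    -- `A₁ : X¹ ∩ D(A) → Z¹` is well defined, closed and densely defined
    ∃ hmaps : ∀ x : A.domain, (x : X) ∈ DAE.X1 E A α → A x ∈ DAE.Z1 E,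
      (DAE.A1 E A α hmaps).IsClosed ∧
      Dense ((DAE.A1 E A α hmaps).domain : Set (DAE.X1 E A α)) ∧
      -- equivalence of the equations on every nondegenerate interval, for solutions and
      -- for classical solutions
      (∀ J : Set ℝ, J.OrdConnected → J.Nontrivial →
        ∀ (x0 : ℝ → DAE.X0 E) (x1 : ℝ → DAE.X1 E A α),
          (DAE.IsSolution E A J (fun t => (x0 t : X) + (x1 t : X)) ↔
            DAE.IsSolution (DAE.blockE (DAE.X0 E) (DAE.X1 E A α))
              (DAE.blockA (DAE.X0 E) (DAE.E1invA1 E A α hmaps)) J (fun t => (x0 t, x1 t))) ∧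
          (DAE.IsClassicalSolution E A J (fun t => (x0 t : X) + (x1 t : X)) ↔
            DAE.IsClassicalSolution (DAE.blockE (DAE.X0 E) (DAE.X1 E A α))
              (DAE.blockA (DAE.X0 E) (DAE.E1invA1 E A α hmaps)) J (fun t => (x0 t, x1 t)))) ∧
      -- `E₁⁻¹ A₁` generates a contraction semigroup on `X¹`
      DAE.GeneratesContractionSemigroup (DAE.E1invA1 E A α hmaps) := by
  have h : DAE.IsDissipativePencil E A := ⟨hA_dense, hA_closed, hE, hres, hdiss, hdiss_adj⟩
  have hm := h.map_mem_Z1 hα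
  refine ⟨fun β hβ => DAE.X1_eq hα hβ, h.isCompl_X hα, h.isCompl_Z,
    fun s hs => h.mem_resolventSet hs, h.exists_projection_X hα, h.exists_projection_Z,
    h.isInvertible_E1 hα, hm, h.isClosed_A1 hm, DAE.IsDissipativePencil.dense_domain_A1 hα hm, ?_,
    h.generates hα hm⟩
  intro J hJ hJ' x0 x1
  have hu := DAE.uniqueDiffOn_of_ordConnected hJ hJ'
  exact ⟨(h.isSolution_iff hα hm hu).trans (DAE.isSolution_block_iff hu).symm,
    (h.isClassicalSolution_iff hα hm hu).trans (DAE.isClassicalSolution_block_iff hu).symm⟩
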